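/- Throughout, $A$ is a unital C*-algebra and $J$ is a finite or countable index set. Hilbert $A$-modules are left modules whose $A$-valued inner product is $A$-linear in the first variable; $\mathcal H\oplus\mathcal K$ carries the inner product $\langle u\oplus v,u'\oplus v'\rangle=\langle u,u'\rangle+\langle v,v'\rangle$. A family $\{x_j\}_{j\in J}$ in a Hilbert $A$-module $\mathcal H$ is a \emph{standard frame} if there are real constants $C,D>0$ such that $$C\langle u,u\rangle\le\sum_{j}\langle u,x_j\rangle\langle x_j,u\rangle\le D\langle u,u\rangle\qquad(u\in\mathcal H)$$ with a norm-convergent sum, and it is \emph{normalized tight} if $C=D=1$ is possible. Let $l_2(A)$ be the Hilbert $A$-module of the families $(a_j)_{j\in J}$ in $A$ for which $\sum_j a_ja_j^*$ converges in norm, with $\langle a,b\rangle=\sum_j a_jb_j^*$. The frame transform $\theta:\mathcal H\to l_2(A)$, $\theta(u)=(\langle u,x_j\rangle)_j$, of a standard frame is adjointable and $\theta^*\theta$ is invertible; the \emph{frame operator} is $S_x=(\theta^*\theta)^{-1}$, and $\{S_x(x_j)\}_j$ is the \emph{canonical dual frame} of $\{x_j\}_j$. Two standard frames $\{x_j\}_j$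 of $\mathcal H$ and $\{y_j\}_j$ of $\mathcal K$ are \emph{strongly disjoint} if there are invertible adjointable bounded $A$-linear operators $T_1$ on $\mathcal H$ and $T_2$ on $\mathcal K$ such that $\{T_1(x_j)\}_j$ and $\{T_2(y_j)\}_j$ are standard normalized tight frames of $\mathcal H$ and $\mathcal K$, respectively, and their inner sum $\{T_1(x_j)\oplus T_2(y_j)\}_j$ is a standard normalized tight frame of $\mathcal H\oplus\mathcal K$. \textbf{Proposition.} Let $\{x_j\}_{j\in J}$ and $\{y_j\}_{j\in J}$ be standard frames of Hilbert $A$-modules $\mathcal H$ and $\mathcal K$, respectively (which are then automatically finitely or countably generated), and let $S_x$ and $S_y$ be their frame operators. The following conditions are equivalent: (i) The frames $\{x_j\}_j$ and $\{y_j\}_j$ are strongly disjoint. (ii) The canonical dual frames $\{S_x(x_j)\}_j$ and $\{S_y(y_j)\}_j$ are strongly disjoint. (iii) The inner sum $\{x_j\oplus y_j\}_j$ is a standard frame of $\mathcal H\oplus\mathcal K$, and its frame operator is $S_{x+y}=S_x\oplus S_y$. (iv) $\sum_j\langle u,S_x(x_j)\rangle\,y_j=0$ for all $u\in\mathcal H$.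 (v) $\sum_j\langle v,S_y(y_j)\rangle\,x_j=0$ for all $v\in\mathcal K$. (vi) $\sum_j\langle u,x_j\rangle\,S_y(y_j)=0$ for all $u\in\mathcal H$. (vii) $\sum_j\langle v,y_j\rangle\,S_x(x_j)=0$ for all $v\in\mathcal K$. (viii) $\sum_j\langle u,x_j\rangle\,y_j=0$ for all $u\in\mathcal H$. (ix) $\sum_j\langle v,y_j\rangle\,x_j=0$ for all $v\in\mathcal K$. The sums in (iv)--(ix) are understood as norm-convergent. Moreover, whenever the inner sum $\{x_j\oplus y_j\}_j$ is a standard frame of $\mathcal H\oplus\mathcal K$, the equality $S_{x+y}=S_x\oplus S_y$ holds if and only if the canonical dual frame of $\{x_j\oplus y_j\}_j$ is the inner sum of the canonical dual frames of $\{x_j\}_j$ and $\{y_j\}_j$. -/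

import Mathlib

open scoped WithCStarModule

noncomputable section

namespace ModuleFrame

/-! ### Inner products and adjoints

`CStarModule A E` is a complex vector space with a left action of `A` and an `A`-valued inner
product `inner A` that is linear in its second variable. The inner product `ip A` below is the same
one with the variables exchanged, so that it is `A`-linear in the first variable. -/

section Inner

variable (A : Type*) {E F : Type*} [CStarAlgebra A] [PartialOrder A]
  [AddCommGroup E] [Module ℂ E] [SMul A E] [Norm E] [CStarModule A E]
  [AddCommGroup F] [Module ℂ F] [SMul A F] [Norm F] [CStarModule A F]

/-- The `A`-valued inner product `⟨u, v⟩`, which satisfies `⟨a u, v⟩ = a ⟨u, v⟩` and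
`⟨u, a v⟩ = ⟨u, v⟩ a*`. -/
abbrev ip (u v : E) : A := inner A v u

/-- `T` and `T'` are adjoint to each other: `⟨T u, v⟩ = ⟨u, T' v⟩` for all `u`, `v`. -/
def IsAdjointPair (T : E → F) (T' : F → E) : Prop :=
  ∀ (u : E) (v : F), ip A (T u) v = ip A u (T' v)

/-- `T` possesses an adjoint. -/
def IsAdjointable (T : E → F) : Prop :=
  ∃ T' : F → E, IsAdjointPair A T T'

open Classical in
/-- The adjoint of an adjointable operator. It is unique since the inner product is
nondegenerate. -/
def adjoint (T : E → F) : F → E :=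
  if h : IsAdjointable A T then h.choose else 0

end Inner

/-! ### The standard Hilbert module `l₂(A)` over an index set -/

section EllTwo

variable (A J : Type*) [CStarAlgebra A] [PartialOrder A] [StarOrderedRing A]

variable {A J} in
lemma summable_add_mul_star {a b : J → A} (ha : Summable fun j => a j * star (a j))
    (hb : Summable fun j => b j * star (b j)) :
    Summable fun j => (a j + b j) * star (a j + b j) := by
  have hs := ((ha.add hb).add (ha.add hb))
  rw [summable_iff_vanishing_norm] at hs ⊢
  intro ε hε
  obtain ⟨s, hs⟩ := hs ε hε
  refine ⟨s, fun t ht => lt_of_le_of_lt ?_ (hs t ht)⟩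
  refine CStarAlgebra.norm_le_norm_of_nonneg_of_le
    (Finset.sum_nonneg fun j _ => mul_star_self_nonneg _) (Finset.sum_le_sum fun j _ => ?_)
  have h := mul_star_self_nonneg (a j - b j)
  rw [← sub_nonneg]
  convert h using 1
  simp only [star_add, star_sub]
  noncomm_ring

/-- The families `(a_j)` in `A` for which `∑ a_j a_j*` converges in norm. -/
def ellTwoSubmodule : Submodule A (J → A) where
  carrier := {a | Summable fun j => a j * star (a j)}
  add_mem' ha hb := summable_add_mul_star ha hb
  zero_mem' := by simp [summable_zero]
  smul_mem' c a ha := by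
    have h := (Summable.mul_left c ha).mul_right (star c)
    simpa [mul_assoc] using h

/-- The Hilbert `A`-module `l₂(A)` of the families `(a_j)` in `A`, indexed by `J`, for which
`∑ a_j a_j*` converges in norm. -/
def EllTwo : Type _ := ellTwoSubmodule A J

namespace EllTwo

instance : AddCommGroup (EllTwo A J) := inferInstanceAs (AddCommGroup (ellTwoSubmodule A J))
instance : Module A (EllTwo A J) := inferInstanceAs (Module A (ellTwoSubmodule A J))
instance : Module ℂ (EllTwo A J) := inferInstanceAs (Module ℂ (ellTwoSubmodule A J))

variable {A J}

/-- The coordinates of an element of `l₂(A)`. -/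
def coord (a : EllTwo A J) : J → A := a.1

@[ext] lemma ext {a b : EllTwo A J} (h : ∀ j, a.coord j = b.coord j) : a = b :=
  Subtype.ext (funext h)

@[simp] lemma coord_add (a b : EllTwo A J) (j : J) : (a + b).coord j = a.coord j + b.coord j := rfl
@[simp] lemma coord_zero (j : J) : (0 : EllTwo A J).coord j = 0 := rfl
@[simp] lemma coord_smul (c : A) (a : EllTwo A J) (j : J) : (c • a).coord j = c * a.coord j := rfl
@[simp] lemma coord_smul_complex (c : ℂ) (a : EllTwo A J) (j : J) :
    (c • a).coord j = c • a.coord j := rfl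

lemma summable_self (a : EllTwo A J) : Summable fun j => a.coord j * star (a.coord j) := a.2

/-- The series defining the inner product of `l₂(A)` converges, by polarization. -/
lemma summable_mul_star (a b : EllTwo A J) :
    Summable fun j => a.coord j * star (b.coord j) := by
  have h1 := (a + b).summable_self
  have h2 := (a + (-1 : ℂ) • b).summable_self
  have h3 := (a + Complex.I • b).summable_self
  have h4 := (a + (-Complex.I) • b).summable_self
  have h := ((h1.sub h2).add ((h3.sub h4).const_smul Complex.I)).const_smul (1 / 4 : ℂ)
  refine h.congr fun j => ?_
  simp only [coord_add, coord_smul_complex, star_add, star_smul, add_mul, mul_add, smul_mul_assoc,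
    mul_smul_comm, Complex.star_def, map_neg, Complex.conj_I, map_one]
  have hI : Complex.I * Complex.I = -1 := Complex.I_mul_I
  match_scalars <;> ring_nf <;> simp <;> norm_num

instance : Norm (EllTwo A J) where
  norm a := √‖∑' j, a.coord j * star (a.coord j)‖

/-- The inner product of `l₂(A)` is `ip A a b = ∑ a_j b_j*`. -/
instance : CStarModule A (EllTwo A J) where
  inner a b := ∑' j, b.coord j * star (a.coord j)
  inner_add_right {a b c} := by
    rw [← (summable_mul_star b a).tsum_add (summable_mul_star c a)]
    simp [add_mul]
  inner_self_nonneg := tsum_nonneg fun j => mul_star_self_nonneg _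
  inner_self {a} := by
    constructor
    · intro h
      have h0 := (summable_self a).hasSum
      rw [h, hasSum_zero_iff_of_nonneg fun j => mul_star_self_nonneg _] at h0
      ext j
      exact (CStarRing.mul_star_self_eq_zero_iff _).1 (congrFun h0 j)
    · rintro rfl
      simp
  inner_op_smul_right {c a b} := by
    rw [← (summable_mul_star b a).tsum_mul_left]
    simp [mul_assoc]
  inner_smul_right_complex {c a b} := by
    rw [← (summable_mul_star b a).tsum_const_smul]
    simp
  star_inner a b := by
    rw [tsum_star]
    simp
  norm_eq_sqrt_norm_inner_self a := rfl

end EllTwo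

end EllTwo

/-! ### Frames -/

section Frame

variable (A : Type*) {J H K : Type*} [CStarAlgebra A] [PartialOrder A] [StarOrderedRing A]
  [NormedAddCommGroup H] [NormedSpace ℂ H] [Module A H] [CStarModule A H]
  [NormedAddCommGroup K] [NormedSpace ℂ K] [Module A K] [CStarModule A K]

/-- The family `x` satisfies, with norm-convergent sums, the frame inequalities
`C ⟨v, v⟩ ≤ ∑ ⟨v, x_j⟩ ⟨x_j, v⟩ ≤ D ⟨v, v⟩` for all `v`. -/
structure IsStandardFrameWith (C D : ℝ) (x : J → H) : Prop where
  summable : ∀ v : H, Summable fun j => ip A v (x j) * ip A (x j) v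
  lower : ∀ v : H, C • ip A v v ≤ ∑' j, ip A v (x j) * ip A (x j) v
  upper : ∀ v : H, ∑' j, ip A v (x j) * ip A (x j) v ≤ D • ip A v v

/-- A standard frame of the Hilbert `A`-module `H`. -/
def IsStandardFrame (x : J → H) : Prop :=
  ∃ C D : ℝ, 0 < C ∧ 0 < D ∧ IsStandardFrameWith A C D x

/-- A standard normalized tight frame of the Hilbert `A`-module `H`. -/
def IsStandardNormalizedTightFrame (x : J → H) : Prop :=
  IsStandardFrameWith A 1 1 x

variable {A} in
/-- The frame transform `θ : H → l₂(A)`, `θ(v) = (⟨v, x_j⟩)_j`, of a standard frame. -/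
def frameTransform {x : J → H} (hx : IsStandardFrame A x) (v : H) : EllTwo A J :=
  ⟨fun j => ip A v (x j), by
    obtain ⟨C, D, -, -, h⟩ := hx
    simpa [ellTwoSubmodule, ip] using h.summable v⟩

variable {A} in
/-- The frame operator `S = (θ* θ)⁻¹ : H → H` of a standard frame. -/
def frameOperator {x : J → H} (hx : IsStandardFrame A x) : H → H :=
  Function.invFun (adjoint A (frameTransform hx) ∘ frameTransform hx)

variable {A} in
/-- The canonical dual frame `(S(x_j))_j` of a standard frame. -/
def canonicalDual {x : J → H} (hx : IsStandardFrame A x) : J → H :=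
  fun j => frameOperator hx (x j)

/-- The inner sum `(x_j ⊕ y_j)_j` in the orthogonal direct sum `H ⊕ K`. -/
def innerSum (x : J → H) (y : J → K) : J → C⋆ᵐᵒᵈ(A, H × K) :=
  fun j => (WithCStarModule.equiv A (H × K)).symm (x j, y j)

/-- The direct sum `S ⊕ T` of operators, acting on the orthogonal direct sum `H ⊕ K`. -/
def directSum (S : H → H) (T : K → K) : C⋆ᵐᵒᵈ(A, H × K) → C⋆ᵐᵒᵈ(A, H × K) :=
  fun w => (WithCStarModule.equiv A (H × K)).symm (S w.1, T w.2)

/-- `(x, y)` and `(z, w)` are similar pairs of families: there are invertible adjointable bounded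
`A`-linear operators `T₁` on `H` and `T₂` on `K` with
`T₁(x_j) ⊕ T₂(y_j) = z_j ⊕ w_j` for all `j`. -/
def SimilarPairs (x : J → H) (y : J → K) (z : J → H) (w : J → K) : Prop :=
  ∃ (T₁ : H ≃L[A] H) (T₂ : K ≃L[A] K),
    IsAdjointable A T₁ ∧ IsAdjointable A T₁.symm ∧
    IsAdjointable A T₂ ∧ IsAdjointable A T₂.symm ∧
    ∀ j, directSum A T₁ T₂ (innerSum A x y j) = innerSum A z w j

/-- Strong disjointness: the pair `(x, y)` is similar to a pair of standard normalized tight frames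
of `H` and `K` whose inner sum is a standard normalized tight frame of `H ⊕ K`. -/
def StronglyDisjoint (x : J → H) (y : J → K) : Prop :=
  ∃ (z : J → H) (w : J → K),
    SimilarPairs A x y z w ∧
    IsStandardNormalizedTightFrame A z ∧ IsStandardNormalizedTightFrame A w ∧
    IsStandardNormalizedTightFrame A (innerSum A z w)

end Frame

end ModuleFrame

end

/-!
All nine conditions express that the ranges of the frame transforms `θ_x` and `θ_y` are orthogonal
in `l₂(A)`, that is, `∑ ⟨u, x_j⟩ ⟨y_j, v⟩ = 0` for all `u` and `v` (`OrthogonalTransforms`). This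
condition is symmetric in `x` and `y`, and it does not change when the families are moved by
operators whose adjoints are onto (`orthogonalTransforms_map_iff`).

* The vanishing of a series such as `∑ ⟨u, x_j⟩ y_j` can be tested against inner products, because
  the upper frame inequality makes `∑ a_j y_j` converge for every `a` in `l₂(A)`
  (`IsStandardFrame.summable_smul`). A frame operator in one of the two places is bounded, symmetric
  and invertible, so it does not affect the condition.
* For the inner sum, `θ* θ` is the direct sum of the operators `θ_x* θ_x` and `θ_y* θ_y` plus the
  off-diagonal terms `θ_x* θ_y` and `θ_y* θ_x`; it is block diagonal exactly when these vanish
  (`frameOperator_innerSum_iff`).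
* Strong disjointness implies orthogonality since the cross terms in the Parseval identity of the
  inner sum vanish (`orthogonalTransforms_of_tight`). Conversely, `T x` is normalized tight for the
  square root `T` of the frame operator of `x`, and `T⁻¹` turns the canonical dual into the same
  tight frame, which settles the disjointness of the frames and that of their duals at once
  (`stronglyDisjoint_iff`).

The root `T` comes from the frame inequalities alone. They show that `P = 1 - θ* θ / c` has norm
less than `1` for a suitable `c > 0` (`norm_le_of_form_le`), and a symmetric root of `1 - P` is then
given by a contraction argument (`exists_sqrt_one_sub`). Hence `θ* θ` is the square of an invertible
symmetric operator. Operators that have an adjoint are automatically `A`-linear, so only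
boundedness and symmetry have to be tracked.

For the last assertion, two symmetric operators that agree on a frame are equal
(`IsStandardFrame.eq_of_symmetric`).
-/

open scoped WithCStarModule

namespace ModuleFrame

/-! ### Symmetric operators on Hilbert modules -/

section Operators

variable {A H K : Type*} [CStarAlgebra A] [PartialOrder A]
  [NormedAddCommGroup H] [NormedSpace ℂ H] [Module A H] [CStarModule A H]
  [NormedAddCommGroup K] [NormedSpace ℂ K] [Module A K] [CStarModule A K]

lemma star_ip (u v : H) : star (ip A u v) = ip A v u := CStarModule.star_inner _ _

lemma eq_of_forall_ip_eq {u w : H} (h : ∀ v, ip A u v = ip A w v) : u = w := by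
  rw [← sub_eq_zero, ← CStarModule.inner_self (A := A), CStarModule.inner_sub_right, sub_eq_zero]
  exact h _

lemma ip_smul_left (a : A) (u v : H) : ip A (a • u) v = a * ip A u v :=
  CStarModule.inner_op_smul_right

lemma ip_smul_right (a : A) (u v : H) : ip A u (a • v) = ip A u v * star a :=
  CStarModule.inner_op_smul_left

lemma IsAdjointPair.symm {T : H → K} {T' : K → H} (h : IsAdjointPair A T T') :
    IsAdjointPair A T' T := fun v u => by
  rw [← star_ip, ← h, star_ip]

lemma isAdjointPair_adjoint {E F : Type*} [AddCommGroup E] [Module ℂ E] [SMul A E] [Norm E]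
    [CStarModule A E] [AddCommGroup F] [Module ℂ F] [SMul A F] [Norm F] [CStarModule A F]
    {T : E → F} (h : IsAdjointable A T) : IsAdjointPair A T (adjoint A T) := by
  rw [adjoint, dif_pos h]
  exact h.choose_spec

lemma IsAdjointPair.map_add {T : H → K} {T' : K → H} (h : IsAdjointPair A T T') (u v : H) :
    T (u + v) = T u + T v :=
  eq_of_forall_ip_eq (A := A) fun w => by
    rw [h, ip, ip, CStarModule.inner_add_right, CStarModule.inner_add_right]
    exact congrArg₂ _ (h u w).symm (h v w).symm

lemma IsAdjointPair.map_smul {T : H → K} {T' : K → H} (h : IsAdjointPair A T T') (a : A) (u : H) :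
    T (a • u) = a • T u :=
  eq_of_forall_ip_eq (A := A) fun w => by
    rw [h, ip_smul_left, ip_smul_left, h]

lemma IsAdjointPair.map_complex_smul {T : H → K} {T' : K → H} (h : IsAdjointPair A T T') (c : ℂ)
    (u : H) : T (c • u) = c • T u :=
  eq_of_forall_ip_eq (A := A) fun w => by
    rw [h, ip, ip, CStarModule.inner_smul_right_complex, CStarModule.inner_smul_right_complex]
    exact congrArg _ (h u w).symm

/-- Mutually inverse bounded symmetric operators form an invertible operator that is linear over
the coefficient algebra. -/
def equivOfSymmetric (R S : H →L[ℂ] H) (hR : IsAdjointPair A R R) (hRS : R * S = 1)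
    (hSR : S * R = 1) : H ≃L[A] H where
  toFun := R
  invFun := S
  map_add' := R.map_add
  map_smul' := hR.map_smul
  left_inv u := DFunLike.congr_fun hSR u
  right_inv u := DFunLike.congr_fun hRS u
  continuous_toFun := R.continuous
  continuous_invFun := S.continuous

lemma IsAdjointPair.equiv_symm {T T' : H ≃L[A] H} (h : IsAdjointPair A T T') :
    IsAdjointPair A T.symm T'.symm := fun u v => by
  conv_lhs => rw [← T'.apply_symm_apply v]
  rw [← h, T.apply_symm_apply]

/-- The adjoint of an invertible operator with adjointable inverse is onto: the adjoint `R` of the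
inverse satisfies `T' (R u) = u`. -/
lemma IsAdjointPair.surjective {T : H ≃L[A] H} {T' : H → H} (h : IsAdjointPair A T T')
    (hs : IsAdjointable A T.symm) : Function.Surjective T' := by
  obtain ⟨R, hR⟩ := hs
  refine fun u => ⟨R u, eq_of_forall_ip_eq (A := A) fun v => ?_⟩
  rw [h.symm, hR.symm, T.symm_apply_apply]

variable [StarOrderedRing A]

lemma hasSum_ip_left {J : Type*} {f : J → H} {w : H} (h : HasSum f w) (v : H) :
    HasSum (fun j => ip A (f j) v) (ip A w v) :=
  h.mapL (CStarModule.innerSL (A := A) v)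

lemma hasSum_ip_right {J : Type*} {f : J → H} {w : H} (h : HasSum f w) (v : H) :
    HasSum (fun j => ip A v (f j)) (ip A v w) := by
  simpa only [star_ip] using (hasSum_ip_left (A := A) h v).star

lemma norm_le_of_ip_le {c : ℝ} (hc : 0 ≤ c) {u : H} {a : A} (h : ip A u u ≤ c • a) :
    ‖u‖ ^ 2 ≤ c * ‖a‖ := by
  rw [CStarModule.norm_sq_eq A, ← Real.norm_of_nonneg hc, ← norm_smul]
  exact CStarAlgebra.norm_le_norm_of_nonneg_of_le CStarModule.inner_self_nonneg h

/-- If `0 ≤ P ≤ p` as quadratic forms, then `‖P‖ ≤ p`. This rests on the identity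
`p (p P - P²) = P (p - P) P + (p - P) P (p - P)`, whose right-hand side is positive. -/
lemma norm_le_of_form_le {P : H →ₗ[ℂ] H} (hP : IsAdjointPair A P P) {p : ℝ} (hp : 0 < p)
    (h0 : ∀ u, 0 ≤ ip A (P u) u) (h1 : ∀ u, ip A (P u) u ≤ p • ip A u u) (u : H) :
    ‖P u‖ ≤ p * ‖u‖ := by
  have key : p • (p • ip A (P u) u - ip A (P u) (P u)) =
      (p • ip A (P u) (P u) - ip A (P (P u)) (P u)) +
        ip A (P ((p : ℂ) • u - P u)) ((p : ℂ) • u - P u) := by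
    have e : ip A (P (P u)) u = ip A (P u) (P u) := hP _ _
    have hc (a : A) : (p : ℂ) • a = p • a := Complex.coe_smul p a
    simp only [map_sub, map_smul, ip, CStarModule.inner_sub_left, CStarModule.inner_sub_right,
      CStarModule.inner_smul_left_complex, CStarModule.inner_smul_right_complex,
      Complex.star_def, Complex.conj_ofReal, hc] at e ⊢
    rw [e]
    module
  have h2 : 0 ≤ p • (p • ip A (P u) u - ip A (P u) (P u)) := by
    rw [key]
    exact add_nonneg (sub_nonneg.2 (h1 _)) (h0 _)
  have h3 : ip A (P u) (P u) ≤ p • ip A (P u) u :=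
    sub_nonneg.1 ((smul_le_smul_iff_of_pos_left hp).1 (by rwa [smul_zero]))
  have h4 : ip A (P u) (P u) ≤ (p * p) • ip A u u := by
    rw [mul_smul]
    exact h3.trans (smul_le_smul_of_nonneg_left (h1 u) hp.le)
  have h5 := norm_le_of_ip_le (by positivity) h4
  rw [ip, ← CStarModule.norm_sq_eq A] at h5
  refine le_of_sq_le_sq ?_ (by positivity)
  linarith [mul_pow p ‖u‖ 2, sq p]

/-- A symmetric `P` with `‖P‖ < 1` admits a symmetric square root `1 - Y` of `1 - P` with
`‖Y‖ < 1`: the equation `(1 - Y)² = 1 - P` says that `Y` is a fixed point of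
`Y ↦ (P + Y²) / 2`, which is a contraction of the ball of radius `‖P‖`. -/
lemma exists_sqrt_one_sub [CompleteSpace H] {P : H →L[ℂ] H} (hP : IsAdjointPair A P P)
    (hn : ‖P‖ < 1) :
    ∃ Y : H →L[ℂ] H, IsAdjointPair A Y Y ∧ ‖Y‖ < 1 ∧ (1 - Y) * (1 - Y) = 1 - P := by
  set f : (H →L[ℂ] H) → (H →L[ℂ] H) := fun Y => (1 / 2 : ℂ) • (P + Y * Y) with hf
  set s : Set (H →L[ℂ] H) := {Y | ‖Y‖ ≤ ‖P‖ ∧ IsAdjointPair A Y Y} with hs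
  have half : ‖(1 / 2 : ℂ)‖ = 1 / 2 := by norm_num
  have hsc : IsComplete s := by
    refine IsClosed.isComplete ?_
    refine (isClosed_le continuous_norm continuous_const).inter ?_
    have e : {Y : H →L[ℂ] H | IsAdjointPair A Y Y} =
        ⋂ u, ⋂ v, {Y : H →L[ℂ] H | ip A (Y u) v = ip A u (Y v)} := by
      ext Y
      simp [IsAdjointPair]
    change IsClosed {Y : H →L[ℂ] H | IsAdjointPair A Y Y}
    rw [e]
    refine isClosed_iInter fun u => isClosed_iInter fun v => isClosed_eq ?_ ?_
    · exact CStarModule.continuous_inner.comp (f := fun Y : H →L[ℂ] H => (v, Y u)) (by fun_prop)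
    · exact CStarModule.continuous_inner.comp (f := fun Y : H →L[ℂ] H => (Y v, u)) (by fun_prop)
  have hsf : Set.MapsTo f s s := by
    rintro Y ⟨h1, h2⟩
    constructor
    · rw [hf, norm_smul, half]
      have h3 := norm_add_le P (Y * Y)
      have h4 := norm_mul_le Y Y
      nlinarith [norm_nonneg Y, norm_nonneg P]
    · intro u v
      have e1 := hP u v
      have e2 : ip A (Y (Y u)) v = ip A u (Y (Y v)) := by rw [h2, h2]
      simp only [ip] at e1 e2
      simp [hf, ip, e1, e2]
  have hK : ContractingWith ‖P‖₊ (hsf.restrict f s s) := by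
    refine ⟨by exact_mod_cast hn, LipschitzWith.of_dist_le_mul ?_⟩
    rintro ⟨Y, hY, -⟩ ⟨Z, hZ, -⟩
    rw [Subtype.dist_eq, Subtype.dist_eq, dist_eq_norm, dist_eq_norm]
    have e : f Y - f Z = (1 / 2 : ℂ) • (Y * (Y - Z) + (Y - Z) * Z) := by
      simp only [hf, ← smul_sub]
      congr 1
      noncomm_ring
    change ‖f Y - f Z‖ ≤ ‖P‖ * ‖Y - Z‖
    rw [e, norm_smul, half]
    have h3 := norm_add_le (Y * (Y - Z)) ((Y - Z) * Z)
    have h4 := norm_mul_le Y (Y - Z)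
    have h5 := norm_mul_le (Y - Z) Z
    nlinarith [norm_nonneg (Y - Z)]
  obtain ⟨Y, ⟨h1, h2⟩, h3, -⟩ := hK.exists_fixedPoint' hsc hsf (x := 0)
    ⟨by simp, fun u v => by simp [ip]⟩ (edist_ne_top _ _)
  refine ⟨Y, h2, h1.trans_lt hn, ?_⟩
  have h4 : P + Y * Y = Y + Y := by
    have h5 : (1 / 2 : ℂ) • (P + Y * Y) = Y := h3
    calc P + Y * Y = (2 : ℂ) • ((1 / 2 : ℂ) • (P + Y * Y)) := by rw [smul_smul]; norm_num
      _ = Y + Y := by rw [h5, two_smul]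
  calc (1 - Y) * (1 - Y) = 1 - (Y + Y) + Y * Y := by noncomm_ring
    _ = 1 - P := by rw [← h4]; abel

/-- A symmetric operator whose quadratic form lies between two positive multiples of the identity
is the square of an invertible symmetric operator. The statement is phrased with the inverse `T`
of that root. -/
lemma exists_symmetric_inverse_sqrt [CompleteSpace H] {G : H → H} (hG : IsAdjointPair A G G)
    {C D : ℝ} (hC : 0 < C) (hD : 0 < D) (h0 : ∀ u, C • ip A u u ≤ ip A (G u) u)
    (h1 : ∀ u, ip A (G u) u ≤ D • ip A u u) :
    ∃ T : H ≃L[A] H, IsAdjointPair A T T ∧ ∀ u, G u = T.symm (T.symm u) := by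
  let Gl : H →ₗ[ℂ] H :=
    { toFun := G, map_add' := hG.map_add, map_smul' := hG.map_complex_smul }
  -- Dividing by `C + D` instead of `D` keeps `p` positive.
  set p : ℝ := D / (C + D) with hp
  have hCD : 0 < C + D := by positivity
  have hp0 : 0 < p := by positivity
  have hp1 : p < 1 := by rw [hp, div_lt_one hCD]; linarith
  let P : H →ₗ[ℂ] H := LinearMap.id - (((C + D)⁻¹ : ℝ) : ℂ) • Gl
  have hPu (u v : H) : ip A (P u) v = ip A u v - (C + D)⁻¹ • ip A (G u) v := by
    change inner A v (u - (((C + D)⁻¹ : ℝ) : ℂ) • G u) = _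
    rw [CStarModule.inner_sub_right, CStarModule.inner_smul_right_complex, Complex.coe_smul]
  have hPs : IsAdjointPair A P P := fun u v => by
    rw [← star_ip (P v) u, hPu, hPu, hG u v, star_sub, star_smul, star_ip, star_ip, star_trivial]
  have hpC : p = 1 - (C + D)⁻¹ * C := by rw [hp]; field_simp; ring
  have hb := norm_le_of_form_le hPs hp0
    (fun u => by
      rw [hPu, sub_nonneg]
      refine (smul_le_smul_of_nonneg_left (h1 u) (inv_nonneg.2 hCD.le)).trans ?_
      rw [smul_smul]
      have h2 : (C + D)⁻¹ * D ≤ 1 := by rw [mul_comm]; exact hp1.le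
      simpa using smul_le_smul_of_nonneg_right h2
        (CStarModule.inner_self_nonneg (A := A) (x := u)))
    (fun u => by
      rw [hPu, hpC, sub_smul, one_smul, mul_smul]
      exact sub_le_sub_left (smul_le_smul_of_nonneg_left (h0 u) (inv_nonneg.2 hCD.le)) _)
  let Pc : H →L[ℂ] H := P.mkContinuous p hb
  obtain ⟨Y, hY, hY1, hYP⟩ := exists_sqrt_one_sub (A := A) (P := Pc) hPs
    ((P.mkContinuous_norm_le hp0.le hb).trans_lt hp1)
  have hsq : ((√(C + D) : ℝ) : ℂ) * ((√(C + D) : ℝ) : ℂ) = ((C + D : ℝ) : ℂ) := by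
    rw [← Complex.ofReal_mul, Real.mul_self_sqrt hCD.le]
  have hc0 : ((√(C + D) : ℝ) : ℂ) ≠ 0 := by
    exact_mod_cast (Real.sqrt_pos.2 hCD).ne'
  set c : ℂ := ((√(C + D) : ℝ) : ℂ) with hc
  set U := Units.oneSub Y hY1 with hU
  have hUv : (U : H →L[ℂ] H) = 1 - Y := rfl
  have hR : IsAdjointPair A (c • (U : H →L[ℂ] H)) (c • (U : H →L[ℂ] H)) := fun u v => by
    have e := hY u v
    simp only [ip] at e
    simp [hUv, ip, e, hc]
  have hRS : (c • (U : H →L[ℂ] H)) * (c⁻¹ • (↑U⁻¹ : H →L[ℂ] H)) = 1 := by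
    rw [smul_mul_smul_comm, U.mul_inv, mul_inv_cancel₀ hc0, one_smul]
  have hSR : (c⁻¹ • (↑U⁻¹ : H →L[ℂ] H)) * (c • (U : H →L[ℂ] H)) = 1 := by
    rw [smul_mul_smul_comm, U.inv_mul, inv_mul_cancel₀ hc0, one_smul]
  let R := equivOfSymmetric _ _ hR hRS hSR
  refine ⟨R.symm, IsAdjointPair.equiv_symm (T := R) (T' := R) hR, fun u => ?_⟩
  have e1 : (c • (U : H →L[ℂ] H)) * (c • (U : H →L[ℂ] H)) = ((C + D : ℝ) : ℂ) • (1 - Pc) := by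
    rw [smul_mul_smul_comm, hsq, hUv, hYP]
  have e2 := DFunLike.congr_fun e1 u
  refine Eq.trans ?_ e2.symm
  change G u = ((C + D : ℝ) : ℂ) • (u - (u - (((C + D)⁻¹ : ℝ) : ℂ) • G u))
  rw [sub_sub_cancel, smul_smul, ← Complex.ofReal_mul, mul_inv_cancel₀ hCD.ne',
    Complex.ofReal_one, one_smul]

end Operators

/-! ### The frame operator -/

section FrameOperator

variable {A J H : Type*} [CStarAlgebra A] [PartialOrder A] [StarOrderedRing A]
  [NormedAddCommGroup H] [NormedSpace ℂ H] [Module A H] [CStarModule A H]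

/-- The bound comes from expanding `∑ (a_j - D⁻¹ ⟨w, x_j⟩) (a_j - D⁻¹ ⟨w, x_j⟩)* ≥ 0` for
`w = ∑ a_j x_j` and applying the upper frame inequality to `w`. -/
lemma IsStandardFrameWith.ip_sum_smul_le {C D : ℝ} {x : J → H} (hx : IsStandardFrameWith A C D x)
    (hD : 0 < D) (F : Finset J) (a : J → A) :
    ip A (∑ j ∈ F, a j • x j) (∑ j ∈ F, a j • x j) ≤ D • ∑ j ∈ F, a j * star (a j) := by
  set w := ∑ j ∈ F, a j • x j with hw
  have e1 : ip A w w = ∑ j ∈ F, a j * ip A (x j) w := by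
    conv_lhs => rw [ip, hw, CStarModule.inner_sum_right]
    exact Finset.sum_congr rfl fun j _ => ip_smul_left _ _ _
  have e2 : ip A w w = ∑ j ∈ F, ip A w (x j) * star (a j) := by
    conv_lhs => rw [ip, hw, CStarModule.inner_sum_left]
    exact Finset.sum_congr rfl fun j _ => ip_smul_right _ _ _
  have h1 : ∑ j ∈ F, ip A w (x j) * ip A (x j) w ≤ D • ip A w w := by
    refine ((hx.summable w).sum_le_tsum F fun j _ => ?_).trans (hx.upper w)
    rw [← star_ip w]
    exact mul_star_self_nonneg _
  have h2 : 0 ≤ ∑ j ∈ F, (a j - D⁻¹ • ip A w (x j)) * star (a j - D⁻¹ • ip A w (x j)) :=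
    Finset.sum_nonneg fun j _ => mul_star_self_nonneg _
  have h3 : ∑ j ∈ F, (a j - D⁻¹ • ip A w (x j)) * star (a j - D⁻¹ • ip A w (x j)) =
      ∑ j ∈ F, a j * star (a j) - D⁻¹ • ip A w w - D⁻¹ • ip A w w +
        D⁻¹ • D⁻¹ • ∑ j ∈ F, ip A w (x j) * ip A (x j) w := by
    nth_rewrite 1 [e1]
    rw [e2]
    simp only [Finset.smul_sum, ← Finset.sum_sub_distrib, ← Finset.sum_add_distrib]
    refine Finset.sum_congr rfl fun j _ => ?_
    simp only [star_sub, star_smul, star_trivial, star_ip, sub_mul, mul_sub, smul_mul_assoc,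
      mul_smul_comm]
    module
  have h4 : D⁻¹ • D⁻¹ • ∑ j ∈ F, ip A w (x j) * ip A (x j) w ≤ D⁻¹ • ip A w w := by
    refine smul_le_smul_of_nonneg_left ?_ (inv_nonneg.2 hD.le)
    rwa [inv_smul_le_iff_of_pos hD]
  rw [← inv_smul_le_iff_of_pos hD, ← sub_nonneg]
  refine (h3 ▸ h2).trans ?_
  rw [sub_add]
  exact sub_le_self _ (sub_nonneg.2 h4)

/-- The synthesis series of a standard frame converges on `l₂(A)`. -/
lemma IsStandardFrame.summable_smul [CompleteSpace H] {x : J → H} (hx : IsStandardFrame A x)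
    {a : J → A} (ha : Summable fun j => a j * star (a j)) : Summable fun j => a j • x j := by
  obtain ⟨C, D, -, hD, h⟩ := hx
  rw [summable_iff_vanishing_norm] at ha ⊢
  intro ε hε
  obtain ⟨s, hs⟩ := ha (ε ^ 2 / D) (by positivity)
  refine ⟨s, fun t ht => lt_of_pow_lt_pow_left₀ 2 hε.le ?_⟩
  refine (norm_le_of_ip_le hD.le (h.ip_sum_smul_le hD t a)).trans_lt ?_
  rw [mul_comm, ← lt_div_iff₀ hD]
  exact hs t ht

lemma isAdjointPair_frameTransform [CompleteSpace H] {x : J → H} (hx : IsStandardFrame A x) :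
    IsAdjointPair A (frameTransform hx) fun a : EllTwo A J => ∑' j, a.coord j • x j := fun u a => by
  have h := hasSum_ip_right (A := A) (hx.summable_smul a.summable_self).hasSum u
  simp only [ip_smul_right] at h
  exact h.tsum_eq

/-- The operator `θ* θ` of a standard frame. -/
noncomputable def gram {x : J → H} (hx : IsStandardFrame A x) : H → H :=
  adjoint A (frameTransform hx) ∘ frameTransform hx

variable [CompleteSpace H]

lemma hasSum_gram {x : J → H} (hx : IsStandardFrame A x) (u v : H) :
    HasSum (fun j => ip A u (x j) * ip A (x j) v) (ip A (gram hx u) v) := by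
  have h := isAdjointPair_adjoint ⟨_, isAdjointPair_frameTransform hx⟩
  have e : ip A (gram hx u) v = ip A (frameTransform hx u) (frameTransform hx v) := by
    have h1 := congrArg star (h v (frameTransform hx u)).symm
    rw [star_ip] at h1
    exact h1.trans (CStarModule.star_inner _ _)
  rw [e]
  have hs := ((frameTransform hx u).summable_mul_star (frameTransform hx v)).hasSum
  refine hs.congr_fun fun j => ?_
  exact congrArg _ (star_ip v (x j)).symm

lemma isAdjointPair_gram {x : J → H} (hx : IsStandardFrame A x) :
    IsAdjointPair A (gram hx) (gram hx) := fun u v => by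
  refine (hasSum_gram hx u v).unique ?_
  simpa only [star_mul, star_ip] using (hasSum_gram hx v u).star

/-- The frame operator is the square of an invertible symmetric operator. -/
lemma exists_frameOperator_sqrt {x : J → H} (hx : IsStandardFrame A x) :
    ∃ T : H ≃L[A] H, IsAdjointPair A T T ∧ (∀ u, gram hx u = T.symm (T.symm u)) ∧
      ∀ u, frameOperator hx u = T (T u) := by
  have ⟨C, D, hC, hD, h⟩ := hx
  obtain ⟨T, hT, hG⟩ := exists_symmetric_inverse_sqrt (isAdjointPair_gram hx) hC hD
    (fun u => (h.lower u).trans_eq (hasSum_gram hx u u).tsum_eq)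
    (fun u => (hasSum_gram hx u u).tsum_eq.symm.trans_le (h.upper u))
  refine ⟨T, hT, hG, fun u => ?_⟩
  have hinj : Function.Injective (gram hx) := fun v w hvw => by
    rw [hG, hG] at hvw
    exact T.symm.injective (T.symm.injective hvw)
  have e : gram hx (T (T u)) = u := by rw [hG]; simp
  calc frameOperator hx u = Function.invFun (gram hx) (gram hx (T (T u))) := by rw [e]; rfl
    _ = T (T u) := Function.leftInverse_invFun hinj _

lemma gram_frameOperator {x : J → H} (hx : IsStandardFrame A x) (u : H) :
    gram hx (frameOperator hx u) = u := by
  obtain ⟨T, -, hG, hS⟩ := exists_frameOperator_sqrt hx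
  simp [hG, hS]

lemma frameOperator_gram {x : J → H} (hx : IsStandardFrame A x) (u : H) :
    frameOperator hx (gram hx u) = u := by
  obtain ⟨T, -, hG, hS⟩ := exists_frameOperator_sqrt hx
  simp [hG, hS]

lemma isAdjointPair_frameOperator {x : J → H} (hx : IsStandardFrame A x) :
    IsAdjointPair A (frameOperator hx) (frameOperator hx) := fun u v => by
  obtain ⟨T, hT, -, hS⟩ := exists_frameOperator_sqrt hx
  rw [hS, hS, hT, hT]

lemma frameOperator_surjective {x : J → H} (hx : IsStandardFrame A x) :
    Function.Surjective (frameOperator hx) := fun u => ⟨_, frameOperator_gram hx u⟩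

/-- The square root `T` of the frame operator of `x` turns `x` into a normalized tight frame, since
`⟨θ* θ T u, T u⟩ = ⟨T⁻¹ u, T u⟩ = ⟨u, u⟩`. -/
lemma isStandardNormalizedTightFrame_of_sqrt {x : J → H} (hx : IsStandardFrame A x)
    {T : H ≃L[A] H} (hT : IsAdjointPair A T T) (hG : ∀ u, gram hx u = T.symm (T.symm u)) :
    IsStandardNormalizedTightFrame A fun j => T (x j) := by
  have h (u : H) : HasSum (fun j => ip A u (T (x j)) * ip A (T (x j)) u) (ip A u u) := by
    have h1 := hasSum_gram hx (T u) (T u)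
    rw [hG, T.symm_apply_apply, ← hT, T.apply_symm_apply] at h1
    refine h1.congr_fun fun j => ?_
    rw [hT, hT]
  exact ⟨fun u => (h u).summable, fun u => by rw [one_smul, (h u).tsum_eq],
    fun u => by rw [one_smul, (h u).tsum_eq]⟩

end FrameOperator

/-! ### Orthogonality of the ranges of two frame transforms -/

section Orthogonal

variable {A J H K : Type*} [CStarAlgebra A] [PartialOrder A]
  [NormedAddCommGroup H] [NormedSpace ℂ H] [Module A H] [CStarModule A H]
  [NormedAddCommGroup K] [NormedSpace ℂ K] [Module A K] [CStarModule A K]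

variable (A) in
/-- The ranges of the frame transforms of `x` and `y` are orthogonal in `l₂(A)`:
`∑ ⟨u, x_j⟩ ⟨y_j, v⟩ = 0` for all `u` and `v`. -/
def OrthogonalTransforms (x : J → H) (y : J → K) : Prop :=
  ∀ (u : H) (v : K), HasSum (fun j => ip A u (x j) * ip A (y j) v) 0

lemma OrthogonalTransforms.symm {x : J → H} {y : J → K} (h : OrthogonalTransforms A x y) :
    OrthogonalTransforms A y x := fun v u => by
  simpa only [star_mul, star_ip, star_zero] using (h u v).star

lemma orthogonalTransforms_comm {x : J → H} {y : J → K} :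
    OrthogonalTransforms A x y ↔ OrthogonalTransforms A y x :=
  ⟨OrthogonalTransforms.symm, OrthogonalTransforms.symm⟩

lemma orthogonalTransforms_map_iff {x : J → H} {y : J → K} {T T' : H → H} {R R' : K → K}
    (hT : IsAdjointPair A T T') (hR : IsAdjointPair A R R') (hT' : Function.Surjective T')
    (hR' : Function.Surjective R') :
    OrthogonalTransforms A (fun j => T (x j)) (fun j => R (y j)) ↔
      OrthogonalTransforms A x y := by
  simp only [OrthogonalTransforms, hR _ _, ← hT.symm _ _]
  constructor
  · intro h u v
    obtain ⟨u, rfl⟩ := hT' u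
    obtain ⟨v, rfl⟩ := hR' v
    exact h u v
  · exact fun h u v => h _ _

lemma IsStandardNormalizedTightFrame.hasSum {x : J → H}
    (hx : IsStandardNormalizedTightFrame A x) (u : H) :
    HasSum (fun j => ip A u (x j) * ip A (x j) u) (ip A u u) := by
  have h1 := hx.lower u
  have h2 := hx.upper u
  rw [one_smul] at h1 h2
  have h := (hx.summable u).hasSum
  rwa [le_antisymm h2 h1] at h

variable [StarOrderedRing A]

/-- Orthogonality tests the series `∑ ⟨u, x_j⟩ y_j` against inner products; its norm convergence,
needed for the converse, comes from `⟨u, x_j⟩` being square summable. -/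
lemma hasSum_smul_iff [CompleteSpace K] {x : J → H} {y : J → K} (hx : IsStandardFrame A x)
    (hy : IsStandardFrame A y) :
    (∀ u : H, HasSum (fun j => ip A u (x j) • y j) 0) ↔ OrthogonalTransforms A x y := by
  constructor
  · intro h u v
    simpa only [ip_smul_left, ip, CStarModule.inner_zero_right] using
      hasSum_ip_left (A := A) (h u) v
  · intro h u
    obtain ⟨w, hw⟩ := hy.summable_smul (frameTransform hx u).summable_self
    have hw0 : w = 0 := eq_of_forall_ip_eq (A := A) fun v => by
      have h1 := hasSum_ip_left (A := A) hw v
      simp only [ip_smul_left] at h1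
      rw [h1.unique (h u v), ip, CStarModule.inner_zero_right]
    exact hw0 ▸ hw

lemma hasSum_ip_symm_smul_iff [CompleteSpace K] {x : J → H} {y : J → K}
    (hx : IsStandardFrame A x) (hy : IsStandardFrame A y) {S : H → H} (hS : IsAdjointPair A S S)
    (hsurj : Function.Surjective S) :
    (∀ u : H, HasSum (fun j => ip A u (S (x j)) • y j) 0) ↔ OrthogonalTransforms A x y := by
  rw [← hasSum_smul_iff hx hy]
  simp only [← hS _ _]
  exact (hsurj.forall (p := fun u => HasSum (fun j => ip A u (x j) • y j) 0)).symm

lemma hasSum_smul_frameOperator_iff [CompleteSpace K] {x : J → H} {y : J → K}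
    (hx : IsStandardFrame A x) (hy : IsStandardFrame A y) :
    (∀ u : H, HasSum (fun j => ip A u (x j) • frameOperator hy (y j)) 0) ↔
      OrthogonalTransforms A x y := by
  obtain ⟨T, -, -, hS⟩ := exists_frameOperator_sqrt hy
  rw [← hasSum_smul_iff hx hy]
  refine forall_congr' fun u => ?_
  have h := (T.trans T).hasSum (L := .unconditional J) (f := fun j => ip A u (x j) • y j) (y := 0)
  rw [map_zero] at h
  rw [← h]
  simp only [map_smul, hS, ContinuousLinearEquiv.trans_apply]

/-! ### Inner sums -/

lemma ip_prod (w w' : C⋆ᵐᵒᵈ(A, H × K)) :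
    ip A w w' = ip A w.1 w'.1 + ip A w.2 w'.2 := rfl

lemma ip_innerSum_mul (x : J → H) (y : J → K) (w w' : C⋆ᵐᵒᵈ(A, H × K)) (j : J) :
    ip A w (innerSum A x y j) * ip A (innerSum A x y j) w' =
      (ip A w.1 (x j) * ip A (x j) w'.1 + ip A w.2 (y j) * ip A (y j) w'.2) +
        (ip A w.1 (x j) * ip A (y j) w'.2 + ip A w.2 (y j) * ip A (x j) w'.1) := by
  change (ip A w.1 (x j) + ip A w.2 (y j)) * (ip A (x j) w'.1 + ip A (y j) w'.2) = _
  noncomm_ring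

lemma OrthogonalTransforms.hasSum_innerSum {x : J → H} {y : J → K}
    (h : OrthogonalTransforms A x y) {w w' : C⋆ᵐᵒᵈ(A, H × K)} {a b : A}
    (ha : HasSum (fun j => ip A w.1 (x j) * ip A (x j) w'.1) a)
    (hb : HasSum (fun j => ip A w.2 (y j) * ip A (y j) w'.2) b) :
    HasSum (fun j => ip A w (innerSum A x y j) * ip A (innerSum A x y j) w') (a + b) := by
  simp only [ip_innerSum_mul]
  simpa only [add_zero] using (ha.add hb).add ((h w.1 w'.2).add (h.symm w.2 w'.1))

/-- If the inner sum of two normalized tight frames is normalized tight, then the cross terms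
`∑ (⟨u, z_j⟩ ⟨w_j, v⟩ + ⟨v, w_j⟩ ⟨z_j, u⟩)` vanish; replacing `u` by `i u` separates them. -/
lemma orthogonalTransforms_of_tight {z : J → H} {w : J → K}
    (hz : IsStandardNormalizedTightFrame A z) (hw : IsStandardNormalizedTightFrame A w)
    (hzw : IsStandardNormalizedTightFrame A (innerSum A z w)) :
    OrthogonalTransforms A z w := fun u v => by
  have cross (u : H) :
      HasSum (fun j => ip A u (z j) * ip A (w j) v + ip A v (w j) * ip A (z j) u) 0 := by
    have h := (IsStandardNormalizedTightFrame.hasSum hzw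
      ((WithCStarModule.equiv A (H × K)).symm (u, v))).sub
      ((IsStandardNormalizedTightFrame.hasSum hz u).add
        (IsStandardNormalizedTightFrame.hasSum hw v))
    rw [ip_prod, WithCStarModule.equiv_symm_fst, WithCStarModule.equiv_symm_snd, sub_self] at h
    refine h.congr_fun fun j => ?_
    rw [ip_innerSum_mul]
    exact (add_sub_cancel_left _ _).symm
  have h := ((cross u).add ((cross (Complex.I • u)).const_smul (-Complex.I))).const_smul (1 / 2 : ℂ)
  simp only [smul_zero, add_zero] at h
  refine h.congr_fun fun j => ?_
  simp only [ip, CStarModule.inner_smul_left_complex, CStarModule.inner_smul_right_complex,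
    smul_mul_assoc, mul_smul_comm, Complex.star_def, Complex.conj_I, smul_add, smul_smul]
  match_scalars
  · linear_combination (1 / 2 : ℂ) * Complex.I_mul_I
  · linear_combination (-1 / 2 : ℂ) * Complex.I_mul_I

lemma OrthogonalTransforms.isStandardFrame_innerSum [CompleteSpace H] [CompleteSpace K]
    {x : J → H} {y : J → K} (h : OrthogonalTransforms A x y) (hx : IsStandardFrame A x)
    (hy : IsStandardFrame A y) : IsStandardFrame A (innerSum A x y) := by
  have ⟨C, D, hC, hD, hx'⟩ := hx
  have ⟨C', D', hC', hD', hy'⟩ := hy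
  have hs (w : C⋆ᵐᵒᵈ(A, H × K)) :=
    h.hasSum_innerSum (w := w) (w' := w) (hx'.summable w.1).hasSum (hy'.summable w.2).hasSum
  refine ⟨min C C', max D D', lt_min hC hC', lt_max_of_lt_left hD, fun w => (hs w).summable,
    fun w => ?_, fun w => ?_⟩
  · rw [(hs w).tsum_eq, ip_prod, smul_add]
    refine add_le_add ((smul_le_smul_of_nonneg_right (min_le_left _ _) ?_).trans (hx'.lower _))
      ((smul_le_smul_of_nonneg_right (min_le_right _ _) ?_).trans (hy'.lower _)) <;>
    exact CStarModule.inner_self_nonneg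
  · rw [(hs w).tsum_eq, ip_prod, smul_add]
    refine add_le_add ((hx'.upper _).trans (smul_le_smul_of_nonneg_right (le_max_left _ _) ?_))
      ((hy'.upper _).trans (smul_le_smul_of_nonneg_right (le_max_right _ _) ?_)) <;>
    exact CStarModule.inner_self_nonneg

/-- The operator `θ* θ` of the inner sum has the off-diagonal entries `θ_x* θ_y` and `θ_y* θ_x`, so
its inverse is block diagonal exactly when these vanish. -/
lemma frameOperator_innerSum_iff [CompleteSpace H] [CompleteSpace K] {x : J → H} {y : J → K}
    (hx : IsStandardFrame A x) (hy : IsStandardFrame A y)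
    (hxy : IsStandardFrame A (innerSum A x y)) :
    frameOperator hxy = directSum A (frameOperator hx) (frameOperator hy) ↔
      OrthogonalTransforms A x y := by
  constructor
  · intro hS u v
    -- `θ* θ (u ⊕ 0)` has no component in `K`, and its inner product with `0 ⊕ v` is the sum.
    set w : C⋆ᵐᵒᵈ(A, H × K) := (WithCStarModule.equiv A (H × K)).symm (u, 0) with hw
    have h1 : directSum A (frameOperator hx) (frameOperator hy) (gram hxy w) = w := by
      rw [← hS, frameOperator_gram]
    have h2 : frameOperator hy (gram hxy w).2 = 0 :=
      congrArg (fun p : C⋆ᵐᵒᵈ(A, H × K) => p.2) h1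
    have h3 : (gram hxy w).2 = 0 := by
      rw [← gram_frameOperator hy (gram hxy w).2, h2]
      refine eq_of_forall_ip_eq (A := A) fun v => ?_
      rw [isAdjointPair_gram hy, ip, ip, CStarModule.inner_zero_right, CStarModule.inner_zero_right]
    have h := hasSum_gram hxy w ((WithCStarModule.equiv A (H × K)).symm (0, v))
    rw [ip_prod, h3] at h
    simpa only [ip_innerSum_mul, hw, WithCStarModule.equiv_symm_fst,
      WithCStarModule.equiv_symm_snd, ip, CStarModule.inner_zero_right,
      CStarModule.inner_zero_left, mul_zero, zero_mul, add_zero, zero_add] using h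
  · intro h
    funext w
    have e : gram hxy (directSum A (frameOperator hx) (frameOperator hy) w) = w :=
      eq_of_forall_ip_eq (A := A) fun w' => by
        have h1 := h.hasSum_innerSum
          (w := directSum A (frameOperator hx) (frameOperator hy) w) (w' := w')
          (hasSum_gram hx (frameOperator hx w.1) w'.1) (hasSum_gram hy (frameOperator hy w.2) w'.2)
        rw [gram_frameOperator, gram_frameOperator] at h1
        exact (hasSum_gram hxy _ w').unique h1
    conv_lhs => rw [← e, frameOperator_gram]

lemma IsAdjointPair.directSum {S : H → H} {T : K → K} (hS : IsAdjointPair A S S)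
    (hT : IsAdjointPair A T T) : IsAdjointPair A (directSum A S T) (directSum A S T) := fun w w' =>
  congrArg₂ (· + ·) (hS w.1 w'.1) (hT w.2 w'.2)

/-- Symmetric operators that agree on a standard frame `x` are equal: the difference of their
values at any `v` is orthogonal to every `x_j`, so the lower frame inequality makes it vanish. -/
lemma IsStandardFrame.eq_of_symmetric {x : J → H} (hx : IsStandardFrame A x) {S T : H → H}
    (hS : IsAdjointPair A S S) (hT : IsAdjointPair A T T) (h : ∀ j, S (x j) = T (x j)) :
    S = T := by
  obtain ⟨C, D, hC, -, hx⟩ := hx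
  funext v
  have h0 (j : J) : ip A (S v - T v) (x j) = 0 := by
    rw [ip, CStarModule.inner_sub_right, sub_eq_zero]
    exact ((hS v (x j)).trans (by rw [h])).trans (hT v (x j)).symm
  have h1 := hx.lower (S v - T v)
  simp only [h0, zero_mul, tsum_zero] at h1
  have h2 : ip A (S v - T v) (S v - T v) ≤ 0 :=
    (smul_le_smul_iff_of_pos_left hC).1 (by rwa [smul_zero])
  exact sub_eq_zero.1 (CStarModule.inner_self.1 (le_antisymm h2 CStarModule.inner_self_nonneg))

/-! ### Strong disjointness -/

/-- Strong disjointness of families that become normalized tight after invertible symmetric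
operators `T` and `R`. The pair `(T x, R y)` witnesses it, and every other witness is an image
of `(x, y)` under operators whose adjoints are onto. -/
lemma stronglyDisjoint_iff {x : J → H} {y : J → K} {T : H ≃L[A] H} {R : K ≃L[A] K}
    (hT : IsAdjointPair A T T) (hR : IsAdjointPair A R R)
    (hx : IsStandardNormalizedTightFrame A fun j => T (x j))
    (hy : IsStandardNormalizedTightFrame A fun j => R (y j)) :
    StronglyDisjoint A x y ↔ OrthogonalTransforms A x y := by
  constructor
  · rintro ⟨z, w, ⟨T₁, T₂, ⟨T₁', h₁⟩, h₁', ⟨T₂', h₂⟩, h₂', hj⟩, hz, hw, hzw⟩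
    have ez : z = fun j => T₁ (x j) :=
      funext fun j => (congrArg (fun p : C⋆ᵐᵒᵈ(A, H × K) => p.1) (hj j)).symm
    have ew : w = fun j => T₂ (y j) :=
      funext fun j => (congrArg (fun p : C⋆ᵐᵒᵈ(A, H × K) => p.2) (hj j)).symm
    have h := orthogonalTransforms_of_tight hz hw hzw
    rw [ez, ew] at h
    exact (orthogonalTransforms_map_iff h₁ h₂ (h₁.surjective h₁') (h₂.surjective h₂')).1 h
  · intro h
    have h' := (orthogonalTransforms_map_iff hT hR T.surjective R.surjective).2 h
    have hs (v : C⋆ᵐᵒᵈ(A, H × K)) := h'.hasSum_innerSum (w := v) (w' := v)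
      (IsStandardNormalizedTightFrame.hasSum hx v.1) (IsStandardNormalizedTightFrame.hasSum hy v.2)
    exact ⟨fun j => T (x j), fun j => R (y j),
      ⟨T, R, ⟨_, hT⟩, ⟨_, hT.equiv_symm⟩, ⟨_, hR⟩, ⟨_, hR.equiv_symm⟩, fun j => rfl⟩, hx, hy,
      fun v => (hs v).summable, fun v => by rw [one_smul, (hs v).tsum_eq, ip_prod],
      fun v => by rw [one_smul, (hs v).tsum_eq, ip_prod]⟩

end Orthogonal

end ModuleFrame

open ModuleFrame in
theorem mainTheorem2
    {A : Type*} [CStarAlgebra A] [PartialOrder A] [StarOrderedRing A]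
    {H : Type*} [NormedAddCommGroup H] [NormedSpace ℂ H] [Module A H] [IsScalarTower ℂ A H]
    [SMulCommClass ℂ A H] [CStarModule A H] [CompleteSpace H]
    {K : Type*} [NormedAddCommGroup K] [NormedSpace ℂ K] [Module A K] [IsScalarTower ℂ A K]
    [SMulCommClass ℂ A K] [CStarModule A K] [CompleteSpace K]
    {J : Type*} [Countable J] (x : J → H) (y : J → K)
    (hx : IsStandardFrame A x) (hy : IsStandardFrame A y) :
    List.TFAE [
      StronglyDisjoint A x y,
      StronglyDisjoint A (canonicalDual hx) (canonicalDual hy),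
      ∃ hxy : IsStandardFrame A (innerSum A x y),
        frameOperator hxy = directSum A (frameOperator hx) (frameOperator hy),
      ∀ u : H, HasSum (fun j => ip A u (frameOperator hx (x j)) • y j) 0,
      ∀ v : K, HasSum (fun j => ip A v (frameOperator hy (y j)) • x j) 0,
      ∀ u : H, HasSum (fun j => ip A u (x j) • frameOperator hy (y j)) 0,
      ∀ v : K, HasSum (fun j => ip A v (y j) • frameOperator hx (x j)) 0,
      ∀ u : H, HasSum (fun j => ip A u (x j) • y j) 0,
      ∀ v : K, HasSum (fun j => ip A v (y j) • x j) 0] ∧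
    ∀ hxy : IsStandardFrame A (innerSum A x y),
      (frameOperator hxy = directSum A (frameOperator hx) (frameOperator hy) ↔
        canonicalDual hxy = innerSum A (canonicalDual hx) (canonicalDual hy)) := by
  obtain ⟨T, hT, hGT, hST⟩ := exists_frameOperator_sqrt hx
  obtain ⟨R, hR, hGR, hSR⟩ := exists_frameOperator_sqrt hy
  have hTx := isStandardNormalizedTightFrame_of_sqrt hx hT hGT
  have hRy := isStandardNormalizedTightFrame_of_sqrt hy hR hGR
  refine ⟨?_, fun hxy => ⟨fun h => ?_, fun h => ?_⟩⟩
  · have h1 := stronglyDisjoint_iff hT hR hTx hRy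
    -- `T⁻¹` and `R⁻¹` turn the canonical duals into the same tight frames `T x` and `R y`.
    have h2 : StronglyDisjoint A (canonicalDual hx) (canonicalDual hy) ↔
        OrthogonalTransforms A x y := by
      refine (stronglyDisjoint_iff hT.equiv_symm hR.equiv_symm ?_ ?_).trans
        (orthogonalTransforms_map_iff (isAdjointPair_frameOperator hx)
          (isAdjointPair_frameOperator hy) (frameOperator_surjective hx)
          (frameOperator_surjective hy))
      · simpa only [canonicalDual, hST, T.symm_apply_apply] using hTx
      · simpa only [canonicalDual, hSR, R.symm_apply_apply] using hRy
    have h3 : (∃ hxy : IsStandardFrame A (innerSum A x y),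
        frameOperator hxy = directSum A (frameOperator hx) (frameOperator hy)) ↔
        OrthogonalTransforms A x y :=
      ⟨fun ⟨hxy, h⟩ => (frameOperator_innerSum_iff hx hy hxy).1 h, fun h =>
        have hxy := h.isStandardFrame_innerSum hx hy
        ⟨hxy, (frameOperator_innerSum_iff hx hy hxy).2 h⟩⟩
    rw [h1, h2, h3,
      hasSum_ip_symm_smul_iff hx hy (isAdjointPair_frameOperator hx) (frameOperator_surjective hx),
      hasSum_ip_symm_smul_iff hy hx (isAdjointPair_frameOperator hy) (frameOperator_surjective hy),
      hasSum_smul_frameOperator_iff hx hy, hasSum_smul_frameOperator_iff hy hx,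
      hasSum_smul_iff hx hy, hasSum_smul_iff hy hx, orthogonalTransforms_comm (x := y)]
    simp
  · funext j
    exact congrFun h (innerSum A x y j)
  · exact hxy.eq_of_symmetric (isAdjointPair_frameOperator hxy)
      ((isAdjointPair_frameOperator hx).directSum (isAdjointPair_frameOperator hy)) (congrFun h)
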